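/- Let $\overline{\mathbb R} = (\mathbb R\cup\{\infty\},\oplus,\odot)$ be the tropical semiring, where $\oplus$ is the minimum and $\odot$ is the usual addition. Let $n,m\ge 0$ and let $I \subseteq \overline{\mathbb R}[x_1^{\pm1},\dots,x_n^{\pm1},y_1^{\pm1},\dots,y_m^{\pm1}]$ be a tropical ideal, that is, an ideal such that for all $f,g\in I$ and every monomial whose coefficients in $f$ and in $g$ are equal and different from $\infty$, there is $h\in I$ in which this monomial has coefficient $\infty$ and such that, for every monomial $\mathbf z^{\mathbf v}$, the coefficients satisfy $[h]_{\mathbf v}\ge\min([f]_{\mathbf v},[g]_{\mathbf v})$, with equality whenever $[f]_{\mathbf v}\neq[g]_{\mathbf v}$. For an ideal $J$ of Laurent polynomials over $\overline{\mathbb R}$ in $k$ variables, let $V(J)\subseteq\mathbb R^k$ be the set of points $\mathbf w$ such that for every $f=\bigoplus_{\mathbf u} c_{\mathbf u}\mathbf z^{\mathbf u}\in J$ with $f\neq\infty$ the minimum $f(\mathbf w)=\min_{\mathbf u}(c_{\mathbf u}+\mathbf u\cdot\mathbf w)$ is attained by at least two distinct $\mathbf u$. Then $$V\bigl(I\cap\overline{\mathbb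 R}[y_1^{\pm1},\dots,y_m^{\pm1}]\bigr)=\pi(V(I)),$$ where $\pi\colon\mathbb R^n\times\mathbb R^m\to\mathbb R^m$ is the projection onto the second factor. -/

import Mathlib

/-- The tropical semiring `ℝ ∪ {∞}`: addition is `min`, multiplication is the usual addition.
Its zero is `∞` and its one is the real number `0`. -/
abbrev TropReal : Type := Tropical (WithTop ℝ)

/-- The semiring of tropical Laurent polynomials in variables indexed by `σ` (finite in all uses):
the monomials are the exponent vectors in `σ → ℤ`. -/
abbrev TropLaurent (σ : Type*) : Type _ := AddMonoidAlgebra TropReal (σ → ℤ)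

namespace TropLaurent

/-- The monomial elimination axiom. In `TropReal`, the zero is `∞`, the sum is the minimum, and the
order is the usual order of `ℝ ∪ {∞}`. -/
def IsTropicalIdeal {σ : Type*} (I : Ideal (TropLaurent σ)) : Prop :=
  ∀ f ∈ I, ∀ g ∈ I, ∀ u : σ → ℤ, f.coeff u = g.coeff u → f.coeff u ≠ 0 →
    ∃ h ∈ I, h.coeff u = 0 ∧
      ∀ v : σ → ℤ, f.coeff v + g.coeff v ≤ h.coeff v ∧
        (f.coeff v ≠ g.coeff v → h.coeff v = f.coeff v + g.coeff v)

/-- The value at `w` of the term of `f` with exponent `u`, that is `[f]_u + u ⋅ w` in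
`ℝ ∪ {∞}`. -/
noncomputable def termValue {σ : Type*} [Fintype σ] (f : TropLaurent σ) (w : σ → ℝ) (u : σ → ℤ) :
    TropReal :=
  f.coeff u * Tropical.trop (((∑ i, (u i : ℝ) * w i : ℝ)) : WithTop ℝ)

/-- The value `f(w)`: the tropical sum, i.e. the minimum, of the values of the terms of `f`. -/
noncomputable def eval {σ : Type*} [Fintype σ] (f : TropLaurent σ) (w : σ → ℝ) : TropReal :=
  ∑ u ∈ f.coeff.support, termValue f w u

/-- The variety of an ideal in `ℝ^σ`: the points `w` such that for every `f` in the ideal either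
`f(w) = ∞` (at a real point this happens only for the polynomial `∞`) or the minimum in `f(w)` is
attained by at least two terms. -/
def variety {σ : Type*} [Fintype σ] (I : Ideal (TropLaurent σ)) : Set (σ → ℝ) :=
  {w | ∀ f ∈ I, eval f w = 0 ∨
    ∃ u v : σ → ℤ, u ≠ v ∧ termValue f w u = eval f w ∧ termValue f w v = eval f w}

/-- Extension of an exponent vector in the `y`-variables by zero in the `x`-variables. -/
def extendExponent (σ τ : Type*) : (τ → ℤ) →+ (σ ⊕ τ → ℤ) where
  toFun v := Sum.elim 0 v
  map_zero' := by
    funext i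
    cases i <;> rfl
  map_add' u v := by
    funext i
    cases i <;> simp

/-- The inclusion of the Laurent polynomials in the variables `y` (indexed by `τ`) into those in the
variables `x` (indexed by `σ`) and `y`. -/
noncomputable def inclusion (σ τ : Type*) : TropLaurent τ →+* TropLaurent (σ ⊕ τ) :=
  AddMonoidAlgebra.mapDomainRingHom TropReal (extendExponent σ τ)

/-- The elimination ideal: the Laurent polynomials in the variables `y` alone that belong
to `I`. -/
noncomputable def eliminationIdeal {σ τ : Type*} (I : Ideal (TropLaurent (σ ⊕ τ))) :
    Ideal (TropLaurent τ) :=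
  I.comap (inclusion σ τ)

/-- The projection `ℝ^σ × ℝ^τ → ℝ^τ`. -/
def proj {σ τ : Type*} (w : σ ⊕ τ → ℝ) : τ → ℝ := fun j => w (Sum.inr j)

end TropLaurent

/-!
# Projections of varieties of tropical ideals

The nontrivial inclusion lifts a point `w` of the variety of the elimination ideal to the variety
of `I`, one variable at a time. Replace `I` by the family of coefficient functions
`u ↦ [f]_u + w ⋅ u` on exponents, so that a point lies in the variety exactly when no member of the
tilted family attains its minimum only once (`mem_variety_iff`). The claim for one variable `x` is
then (`exists_homogeneous_unique_min`): if for every slope `a` some `F` in the family is such that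
`F + a * x` has a unique minimum, then some member of the family that is homogeneous in `x` has a
unique minimum.

Two ingredients prove it. The first is a finiteness result for tropical initial degenerations along
a ray (`exists_lex_min_of_unique_min`): for large `l`, an exponent which is the unique minimum of
some `F + l * ω` is also the unique minimum of some `H` with respect to the lexicographic order
given by `ω` first and the value second, that is, for `l = ∞`. The leading exponents for `l = ∞`
in all boxes of exponents are generated under translation by finitely many of them, by Dickson's
lemma, hence they are leading exponents for all large `l`; and the number of leading exponents in
a box cannot jump, because tropical Gaussian elimination (`IsElim.exists_vanishing`) produces, from
more than `k` members with distinct leading exponents, a nonzero one avoiding `k` given exponents.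

The second is elimination against a concave potential. Applied to `ω = x` and `ω = -x`, the
finiteness result provides members with a one-sided support in `x` that work near `a = ± ∞`, and
compactness gives uniform bounds for the remaining slopes. With the potential `-ε * x ^ 2`, whose
slope at `q` is `-2 * ε * q`, the translates of these members become rows with a strictly dominant
entry at every exponent of a strip `|x| ≤ N`, supported in that strip. Eliminating with them all
exponents with `x ≠ 0` of small value gives, for every `K`, a member with a unique minimum at `0`
whose values off the hyperplane `x = 0` are at least `K`. The finiteness result for the weight that
separates this hyperplane from its complement, in boxes of bounded width in `x`, turns this into a
member supported on the hyperplane.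
-/

namespace TropLaurent

/-! ### Tropical Gaussian elimination -/

/-- A set of functions `F : α → ℝ ∪ {∞}` closed under adding real constants and satisfying the
monomial elimination axiom. Sums (pointwise minima) of members need not be members. -/
structure IsElim {α : Type*} (T : Set (α → WithTop ℝ)) : Prop where
  add_const : ∀ F ∈ T, ∀ c : ℝ, (fun u => F u + (c : WithTop ℝ)) ∈ T
  elim : ∀ F ∈ T, ∀ G ∈ T, ∀ u, F u = G u → F u ≠ ⊤ →
    ∃ H ∈ T, H u = ⊤ ∧ ∀ v, min (F v) (G v) ≤ H v ∧ (F v ≠ G v → H v = min (F v) (G v))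

/-- The function `F + ρ`, for a real weight `ρ`. -/
def tilt {α : Type*} (ρ : α → ℝ) (F : α → WithTop ℝ) : α → WithTop ℝ :=
  fun u => F u + (ρ u : WithTop ℝ)

section Order

variable {α Γ : Type*} [LinearOrder Γ]

/-- `e` is the leading exponent of `F`: the one of least value, ties being broken by the least
value of `τ`. -/
def IsLead (τ : α → Γ) (F : α → WithTop ℝ) (e : α) : Prop :=
  F e ≠ ⊤ ∧ ∀ u, u ≠ e → F e < F u ∨ F e = F u ∧ τ e < τ u

/-- `e` is the leading exponent of `F` for the lexicographic order that compares the weight `ω`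
first, then the value of `F`, then `τ`. This is the limit of the leading exponents of `F + l * ω`
as `l → ∞`. -/
def IsLexLead (τ : α → Γ) (ω : α → ℝ) (F : α → WithTop ℝ) (e : α) : Prop :=
  F e ≠ ⊤ ∧ ∀ u, u ≠ e → F u ≠ ⊤ →
    ω e < ω u ∨ ω e = ω u ∧ (F e < F u ∨ F e = F u ∧ τ e < τ u)

lemma tilt_eq_top_iff {ρ : α → ℝ} {F : α → WithTop ℝ} {u : α} : tilt ρ F u = ⊤ ↔ F u = ⊤ := by
  simp [tilt]

lemma add_coe_min (a b : WithTop ℝ) (c : ℝ) :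
    min (a + (c : WithTop ℝ)) (b + (c : WithTop ℝ)) = min a b + (c : WithTop ℝ) :=
  (min_add_add_right a b _)

lemma IsElim.tilt {T : Set (α → WithTop ℝ)} (hT : IsElim T) (ρ : α → ℝ) :
    IsElim (tilt ρ '' T) where
  add_const := by
    rintro _ ⟨F, hF, rfl⟩ c
    refine ⟨_, hT.add_const F hF c, ?_⟩
    funext u
    simp only [TropLaurent.tilt]
    exact add_right_comm _ _ _
  elim := by
    rintro _ ⟨F, hF, rfl⟩ _ ⟨G, hG, rfl⟩ u h hne
    simp only [TropLaurent.tilt] at h hne ⊢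
    have hFG : F u = G u := (WithTop.add_right_inj WithTop.coe_ne_top).1 h
    obtain ⟨H, hH, hHu, hHv⟩ := hT.elim F hF G hG u hFG (fun h0 => hne (by simp [h0]))
    refine ⟨_, ⟨H, hH, rfl⟩, by simp [TropLaurent.tilt, hHu], fun v => ⟨?_, fun hv => ?_⟩⟩
    · rw [add_coe_min]
      exact add_le_add_left (hHv v).1 _
    · rw [add_coe_min]
      simp only [TropLaurent.tilt]
      rw [(hHv v).2 (fun h0 => hv (by rw [h0]))]

lemma IsElim.inter_vanishing {T : Set (α → WithTop ℝ)} (hT : IsElim T) (a : α) :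
    IsElim {F ∈ T | F a = ⊤} where
  add_const := fun F hF c => ⟨hT.add_const F hF.1 c, by simp [hF.2]⟩
  elim := by
    rintro F ⟨hF, hFa⟩ G ⟨hG, hGa⟩ u h hne
    obtain ⟨H, hH, hHu, hHv⟩ := hT.elim F hF G hG u h hne
    refine ⟨H, ⟨hH, ?_⟩, hHu, hHv⟩
    have := (hHv a).1
    rwa [hFa, hGa, min_self, top_le_iff] at this

lemma IsElim.exists_normalized {T : Set (α → WithTop ℝ)} (hT : IsElim T) {F : α → WithTop ℝ}
    (hF : F ∈ T) {e : α} (he : F e ≠ ⊤) (c : ℝ) :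
    ∃ d : ℝ, (fun u => F u + (d : WithTop ℝ)) ∈ T ∧ F e + (d : WithTop ℝ) = c := by
  obtain ⟨r, hr⟩ := WithTop.ne_top_iff_exists.1 he
  refine ⟨c - r, hT.add_const F hF _, ?_⟩
  rw [← hr, ← WithTop.coe_add]
  congr 1
  ring

/-- Tropical Gaussian elimination: from members of `T` with more than `A.card` distinct leading
exponents one obtains a nonzero member of `T` vanishing (that is, equal to `∞`) on `A`. -/
lemma IsElim.exists_vanishing {τ : α → Γ} (hτ : Function.Injective τ) (A : Finset α) :
    ∀ (T : Set (α → WithTop ℝ)), IsElim T → ∀ L : Finset α, A.card < L.card →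
      (∀ e ∈ L, ∃ F ∈ T, IsLead τ F e) →
      ∃ F ∈ T, (∃ u, F u ≠ ⊤) ∧ ∀ a ∈ A, F a = ⊤ := by
  classical
  induction A using Finset.induction_on with
  | empty =>
    intro T hT L hL h
    obtain ⟨e, he⟩ := Finset.card_pos.1 (by simpa using hL)
    obtain ⟨F, hF, hFe⟩ := h e he
    exact ⟨F, hF, ⟨e, hFe.1⟩, by simp⟩
  | insert a A ha ih =>
    intro T hT L hL h
    have h0 : ∀ e ∈ L, ∃ F ∈ T, F e = 0 ∧ ∀ u, u ≠ e → 0 < F u ∨ F u = 0 ∧ τ e < τ u := by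
      intro e he
      obtain ⟨F, hF, hFe, hlead⟩ := h e he
      obtain ⟨d, hd, hde⟩ := hT.exists_normalized hF hFe 0
      refine ⟨_, hd, by simpa using hde, fun u hu => ?_⟩
      have hde' : F e + (d : WithTop ℝ) = 0 := by simpa using hde
      rw [← hde']
      rcases hlead u hu with h1 | ⟨h1, h2⟩
      · exact Or.inl ((WithTop.add_lt_add_iff_right WithTop.coe_ne_top).2 h1)
      · exact Or.inr ⟨by simp [h1], h2⟩
    choose! f hfT hf0 hf using h0
    rw [Finset.card_insert_of_notMem ha] at hL
    -- The pivot row has the least gap between the value at `a` and the leading value, ties being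
    -- resolved in favour of the largest `τ`: then no other leading exponent is disturbed.
    obtain ⟨p, hp, hpmin⟩ := Finset.exists_min_image L
      (fun e => toLex (f e a, OrderDual.toDual (τ e))) (Finset.card_pos.1 (by omega))
    obtain ⟨F, hF, hne, hvan⟩ := ih {F ∈ T | F a = ⊤} (hT.inter_vanishing a) (L.erase p)
      (by rw [Finset.card_erase_of_mem hp]; omega) (by
        intro e he
        obtain ⟨hep, heL⟩ := Finset.mem_erase.1 he
        by_cases hea : f e a = ⊤
        · refine ⟨f e, ⟨hfT e heL, hea⟩, by simp [hf0 e heL], fun u hu => ?_⟩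
          rw [hf0 e heL]
          rcases hf e heL u hu with h1 | ⟨h1, h2⟩
          · exact Or.inl h1
          · exact Or.inr ⟨h1.symm, h2⟩
        have hmin := hpmin e heL
        rw [Prod.Lex.le_iff] at hmin
        simp only [ofLex_toLex, OrderDual.toDual_le_toDual] at hmin
        have hpa : f p a ≠ ⊤ := by
          rcases hmin with h1 | ⟨h1, -⟩
          · exact h1.ne_top
          · rwa [h1]
        obtain ⟨r, hr⟩ := WithTop.ne_top_iff_exists.1 hea
        obtain ⟨s, hs⟩ := WithTop.ne_top_iff_exists.1 hpa
        rw [← hr, ← hs] at hmin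
        simp only [WithTop.coe_lt_coe, WithTop.coe_inj] at hmin
        have hgap : s < r ∨ s = r ∧ τ e < τ p := by
          rcases hmin with h1 | ⟨h1, h2⟩
          · exact Or.inl h1
          · exact Or.inr ⟨h1, lt_of_le_of_ne h2 (fun h3 => hep (hτ h3))⟩
        -- the scaled pivot row is positive or ties only at exponents after `e`
        have hg : ∀ u, 0 < f p u + ((r - s : ℝ) : WithTop ℝ) ∨
            f p u + ((r - s : ℝ) : WithTop ℝ) = 0 ∧ τ e < τ u := by
          intro u
          have hpu : 0 < f p u ∨ f p u = 0 ∧ τ p ≤ τ u := by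
            by_cases hup : u = p
            · subst hup; exact Or.inr ⟨hf0 _ hp, le_rfl⟩
            · exact (hf p hp u hup).imp_right fun h => ⟨h.1, h.2.le⟩
          rcases hgap with h1 | ⟨h1, h2⟩
          · left
            have : (0 : WithTop ℝ) < ((r - s : ℝ) : WithTop ℝ) := by
              exact_mod_cast sub_pos.2 h1
            rcases hpu with h3 | ⟨h3, -⟩
            · exact lt_of_lt_of_le this (le_add_of_nonneg_left h3.le)
            · rw [h3, zero_add]; exact this
          · subst h1
            simp only [sub_self, WithTop.coe_zero, add_zero]
            exact hpu.imp_right fun h => ⟨h.1, h2.trans_le h.2⟩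
        obtain ⟨H, hH, hHa, hHv⟩ := hT.elim (f e) (hfT e heL) _
          (hT.add_const (f p) (hfT p hp) (r - s)) a
          (by rw [← hr, ← hs, ← WithTop.coe_add]; congr 1; ring) hea
        have hHe : H e = 0 := by
          have hpos : 0 < f p e + ((r - s : ℝ) : WithTop ℝ) :=
            (hg e).resolve_right fun h => lt_irrefl _ h.2
          rw [(hHv e).2 (by rw [hf0 e heL]; exact hpos.ne), hf0 e heL, min_eq_left hpos.le]
        refine ⟨H, ⟨hH, hHa⟩, by simp [hHe], fun u hu => ?_⟩
        rw [hHe]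
        have hle := (hHv u).1
        have h0 : 0 ≤ H u := by
          refine (le_min ?_ ?_).trans hle
          · exact (hf e heL u hu).elim le_of_lt fun h => h.1.ge
          · exact (hg u).elim le_of_lt fun h => h.1.ge
        rcases h0.lt_or_eq with h5 | h5
        · exact Or.inl h5
        refine Or.inr ⟨h5, ?_⟩
        rw [← h5, min_le_iff] at hle
        rcases hle with h6 | h6
        · exact ((hf e heL u hu).resolve_left h6.not_gt).2
        · exact ((hg u).resolve_left h6.not_gt).2)
    refine ⟨F, hF.1, hne, fun b hb => ?_⟩
    rcases Finset.mem_insert.1 hb with rfl | hb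
    · exact hF.2
    · exact hvan b hb

lemma exists_isLexLead {τ : α → Γ} (hτ : Function.Injective τ) (ω : α → ℝ) {F : α → WithTop ℝ}
    (hfin : {u | F u ≠ ⊤}.Finite) (hne : ∃ u, F u ≠ ⊤) : ∃ e, IsLexLead τ ω F e := by
  obtain ⟨e, he, hmin⟩ := Set.exists_min_image _ (fun u => toLex (ω u, toLex (F u, τ u))) hfin hne
  refine ⟨e, he, fun u hu hFu => ?_⟩
  have h := hmin u hFu
  simp only [Prod.Lex.le_iff, ofLex_toLex] at h
  rcases h with h | ⟨h, h1 | ⟨h1, h2⟩⟩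
  · exact Or.inl h
  · exact Or.inr ⟨h, Or.inl h1⟩
  · exact Or.inr ⟨h, Or.inr ⟨h1, lt_of_le_of_ne h2 fun h3 => hu (hτ h3).symm⟩⟩

lemma exists_isLead {τ : α → Γ} (hτ : Function.Injective τ) {F : α → WithTop ℝ}
    (hfin : {u | F u ≠ ⊤}.Finite) (hne : ∃ u, F u ≠ ⊤) : ∃ e, IsLead τ F e := by
  obtain ⟨e, he, h⟩ := exists_isLexLead hτ (fun _ => 0) hfin hne
  refine ⟨e, he, fun u hu => ?_⟩
  by_cases hFu : F u = ⊤
  · left; rw [hFu]; exact lt_top_iff_ne_top.2 he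
  · simpa using h u hu hFu

lemma IsLexLead.eventually_isLead {τ : α → Γ} {ω : α → ℝ} {F : α → WithTop ℝ} {e : α}
    (hfin : {u | F u ≠ ⊤}.Finite) (h : IsLexLead τ ω F e) :
    ∀ᶠ l : ℝ in Filter.atTop, IsLead τ (tilt (fun u => l * ω u) F) e := by
  have key : ∀ᶠ l : ℝ in Filter.atTop, ∀ u ∈ hfin.toFinset, u ≠ e →
      tilt (fun u => l * ω u) F e < tilt (fun u => l * ω u) F u ∨
        tilt (fun u => l * ω u) F e = tilt (fun u => l * ω u) F u ∧ τ e < τ u := by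
    rw [Filter.eventually_all_finset]
    intro u hu
    have hFu : F u ≠ ⊤ := by simpa using hu
    by_cases hue : u = e
    · simp [hue]
    obtain ⟨r, hr⟩ := WithTop.ne_top_iff_exists.1 h.1
    obtain ⟨s, hs⟩ := WithTop.ne_top_iff_exists.1 hFu
    have h2 := h.2 u hue hFu
    simp only [tilt, ← hr, ← hs, ← WithTop.coe_add, WithTop.coe_lt_coe, WithTop.coe_inj] at h2 ⊢
    rcases h2 with h2 | ⟨h2, h3⟩
    · filter_upwards [Filter.eventually_gt_atTop ((r - s) / (ω u - ω e))] with l hl _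
      rw [div_lt_iff₀ (sub_pos.2 h2)] at hl
      left
      nlinarith
    · refine Filter.Eventually.of_forall fun l _ => ?_
      rw [h2]
      simpa using h3
  filter_upwards [key] with l hl
  refine ⟨by rw [Ne, tilt_eq_top_iff]; exact h.1, fun u hu => ?_⟩
  by_cases hFu : F u = ⊤
  · left
    rw [tilt_eq_top_iff.2 hFu, lt_top_iff_ne_top, Ne, tilt_eq_top_iff]
    exact h.1
  · exact hl u (by simpa using hFu) hu

end Order

/-! ### Stabilization of initial degenerations along a ray -/

section Stabilization

/-- A set of functions on exponent vectors with the formal properties of the coefficient functions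
of a tropical ideal that the argument needs: elimination, finite supports, and invariance under
translation (multiplication by monomials). -/
structure IsTropFamily {σ : Type*} (T : Set ((σ → ℤ) → WithTop ℝ)) : Prop extends IsElim T where
  finite_support : ∀ F ∈ T, {u | F u ≠ ⊤}.Finite
  translate : ∀ F ∈ T, ∀ s : σ → ℤ, (fun u => F (u - s)) ∈ T

/-- `F` attains its minimum at `e` only, and this minimum is finite. -/
def IsUniqueMin {α : Type*} (F : α → WithTop ℝ) (e : α) : Prop :=
  F e ≠ ⊤ ∧ ∀ u, u ≠ e → F e < F u

/-- The members of `T` supported in the box of exponents between `0` and `b`. -/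
def boxed {σ : Type*} (T : Set ((σ → ℤ) → WithTop ℝ)) (b : σ → ℤ) :
    Set ((σ → ℤ) → WithTop ℝ) :=
  {F ∈ T | ∀ u, F u ≠ ⊤ → 0 ≤ u ∧ u ≤ b}

lemma IsElim.boxed {σ : Type*} {T : Set ((σ → ℤ) → WithTop ℝ)} (hT : IsElim T) (b : σ → ℤ) :
    IsElim (boxed T b) where
  add_const := fun F hF c => ⟨hT.add_const F hF.1 c, fun u hu => hF.2 u (by simpa using hu)⟩
  elim := by
    rintro F ⟨hF, hFb⟩ G ⟨hG, hGb⟩ u h hne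
    obtain ⟨H, hH, hHu, hHv⟩ := hT.elim F hF G hG u h hne
    refine ⟨H, ⟨hH, fun v hv => ?_⟩, hHu, hHv⟩
    have h1 := ((hHv v).1.trans_lt (lt_top_iff_ne_top.2 hv))
    rcases min_lt_iff.1 h1 with h2 | h2
    · exact hFb v h2.ne
    · exact hGb v h2.ne

lemma tilt_translate {σ : Type*} {ω : (σ → ℤ) → ℝ} {s : σ → ℤ}
    (hω : ∀ u v, ω (u + s) - ω u = ω (v + s) - ω v) (l : ℝ) (F : (σ → ℤ) → WithTop ℝ)
    (e v : σ → ℤ) :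
    tilt (fun u => l * ω u) (fun u => F (u - s)) (v + s) =
      tilt (fun u => l * ω u) F v + ((l * (ω (e + s) - ω e) : ℝ) : WithTop ℝ) := by
  simp only [tilt, add_sub_cancel_right]
  rw [add_assoc, ← WithTop.coe_add, hω e v]
  congr 2
  ring

/-- The exponent vectors embedded, by an enumeration of the variables, in a lexicographically
ordered group: a translation invariant total order on exponents that breaks ties. -/
noncomputable def lexTie {σ : Type*} [Fintype σ] (u : σ → ℤ) : Lex (Fin (Fintype.card σ) → ℤ) :=
  toLex fun i => u ((Fintype.equivFin σ).symm i)

variable {σ : Type*} [Fintype σ]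

lemma lexTie_injective : Function.Injective (lexTie (σ := σ)) := by
  intro u v h
  funext i
  simpa using congrFun (toLex.injective h) (Fintype.equivFin σ i)

lemma lexTie_add (u v : σ → ℤ) : lexTie (u + v) = lexTie u + lexTie v := rfl

lemma lexTie_add_lt_add_iff {u v s : σ → ℤ} :
    lexTie (u + s) < lexTie (v + s) ↔ lexTie u < lexTie v := by
  rw [lexTie_add, lexTie_add]
  exact add_lt_add_iff_right _

lemma IsLead.translate {ω : (σ → ℤ) → ℝ} {l : ℝ} {F : (σ → ℤ) → WithTop ℝ} {e s : σ → ℤ}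
    (hω : ∀ u v, ω (u + s) - ω u = ω (v + s) - ω v)
    (h : IsLead lexTie (tilt (fun u => l * ω u) F) e) :
    IsLead lexTie (tilt (fun u => l * ω u) fun u => F (u - s)) (e + s) := by
  refine ⟨?_, fun u hu => ?_⟩
  · rw [tilt_translate hω l F e, Ne, WithTop.add_eq_top, not_or]
    exact ⟨h.1, WithTop.coe_ne_top⟩
  obtain ⟨v, rfl⟩ : ∃ v, u = v + s := ⟨u - s, by simp⟩
  rw [tilt_translate hω l F e, tilt_translate hω l F e,
    WithTop.add_lt_add_iff_right WithTop.coe_ne_top, WithTop.add_right_inj WithTop.coe_ne_top]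
  exact (h.2 v fun h => hu (by rw [h])).imp_right fun h => ⟨h.1, lexTie_add_lt_add_iff.2 h.2⟩

/-- For large `l`, every lexicographic leading exponent in a box of the collection `B` is the
leading exponent of some member of the box tilted by `l * ω`. The hypothesis on `ω` says that a
translation of a box of `B` into another one changes `ω` by a constant. -/
lemma exists_forall_isLead_of_isLexLead {T : Set ((σ → ℤ) → WithTop ℝ)} (hT : IsTropFamily T)
    (B : Set (σ → ℤ)) (ω : (σ → ℤ) → ℝ)
    (hω : ∀ b ∈ B, ∀ b' ∈ B, ∀ s, 0 ≤ s → b + s ≤ b' →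
      ∀ u v, ω (u + s) - ω u = ω (v + s) - ω v) :
    ∃ l₀ : ℝ, ∀ l ≥ l₀, ∀ b ∈ B, ∀ e, ∀ F ∈ boxed T b, IsLexLead lexTie ω F e →
      ∃ F' ∈ boxed T b, IsLead lexTie (tilt (fun u => l * ω u) F') e := by
  by_contra! hcon
  -- By Dickson's lemma, among failures for `l → ∞` one box and exponent translate into
  -- infinitely many later ones. The second block of coordinates keeps the translate in the box.
  choose l hl b hb e F hF hlex hno using fun k : ℕ => hcon k
  have hwqo : WellQuasiOrderedLE (σ ⊕ σ → ℕ) := inferInstance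
  obtain ⟨g, hg⟩ := hwqo.wqo.exists_monotone_subseq
    (fun k => Sum.elim (fun i => (e k i).toNat) (fun i => (b k i - e k i).toNat))
  have hbox : ∀ k, 0 ≤ e k ∧ e k ≤ b k := fun k => (hF k).2 _ (hlex k).1
  obtain ⟨n, hn⟩ : ∃ n : ℕ,
      IsLead lexTie (tilt (fun u => l (g n) * ω u) (F (g 0))) (e (g 0)) := by
    have h1 := (hlex (g 0)).eventually_isLead (hT.finite_support _ (hF (g 0)).1)
    obtain ⟨L, hL⟩ := Filter.eventually_atTop.1 h1
    obtain ⟨n, hn⟩ := exists_nat_ge L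
    refine ⟨n, hL _ (hn.trans (le_trans ?_ (hl _)))⟩
    exact_mod_cast g.strictMono.id_le n
  have hmono := hg 0 n (Nat.zero_le n)
  have hs : ∀ i, e (g 0) i ≤ e (g n) i ∧ b (g 0) i - e (g 0) i ≤ b (g n) i - e (g n) i := by
    intro i
    have h1 : (e (g 0) i).toNat ≤ (e (g n) i).toNat := hmono (Sum.inl i)
    have h2 : (b (g 0) i - e (g 0) i).toNat ≤ (b (g n) i - e (g n) i).toNat :=
      hmono (Sum.inr i)
    have h3 : 0 ≤ e (g n) i := (hbox (g n)).1 i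
    have h4 : e (g n) i ≤ b (g n) i := (hbox (g n)).2 i
    have h5 : 0 ≤ e (g 0) i := (hbox (g 0)).1 i
    have h6 : e (g 0) i ≤ b (g 0) i := (hbox (g 0)).2 i
    omega
  refine hno (g n) (fun u => F (g 0) (u - (e (g n) - e (g 0))))
    ⟨hT.translate _ (hF _).1 _, fun u hu => ?_⟩ ?_
  · have := (hF (g 0)).2 _ hu
    constructor <;> intro i <;> have h1 := this.1 i <;> have h2 := this.2 i <;>
      have h3 := hs i <;> simp only [Pi.sub_apply, Pi.zero_apply] at * <;> omega
  · have := hn.translate (s := e (g n) - e (g 0)) (hω _ (hb (g 0)) _ (hb (g n)) _ ?_ ?_)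
    · simpa using this
    · intro i
      have h3 := hs i
      simp only [Pi.sub_apply, Pi.zero_apply]
      omega
    · intro i
      have h3 := hs i
      simp only [Pi.sub_apply, Pi.add_apply]
      omega

lemma IsUniqueMin.isLead {α Γ : Type*} [LinearOrder Γ] {τ : α → Γ} {F : α → WithTop ℝ} {e : α}
    (h : IsUniqueMin F e) : IsLead τ F e :=
  ⟨h.1, fun u hu => Or.inl (h.2 u hu)⟩

/-- Stabilization along the ray `l * ω`: for all large `l`, uniformly in the box, the unique
minimum of some `F + l * ω` is the unique lexicographic minimum of some member of the family. -/
theorem exists_lex_min_of_unique_min {T : Set ((σ → ℤ) → WithTop ℝ)} (hT : IsTropFamily T)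
    (B : Set (σ → ℤ)) (ω : (σ → ℤ) → ℝ)
    (hω : ∀ b ∈ B, ∀ b' ∈ B, ∀ s, 0 ≤ s → b + s ≤ b' →
      ∀ u v, ω (u + s) - ω u = ω (v + s) - ω v) :
    ∃ l₀ : ℝ, ∀ l ≥ l₀, ∀ b ∈ B, ∀ e, ∀ F ∈ boxed T b,
      IsUniqueMin (tilt (fun u => l * ω u) F) e →
      ∃ H ∈ T, H e ≠ ⊤ ∧ ∀ u, u ≠ e → H u ≠ ⊤ → ω e < ω u ∨ ω e = ω u ∧ H e < H u := by
  classical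
  obtain ⟨l₀, hl₀⟩ := exists_forall_isLead_of_isLexLead hT B ω hω
  refine ⟨l₀, fun l hl b hb e F hF hmin => ?_⟩
  have hTl : IsElim (tilt (fun u => l * ω u) '' boxed T b) := (hT.boxed b).tilt _
  have hfin : ∀ G ∈ boxed T b, {u | tilt (fun u => l * ω u) G u ≠ ⊤}.Finite := fun G hG => by
    simpa [tilt_eq_top_iff] using hT.finite_support G hG.1
  -- the set of lexicographic leading exponents in the box
  have hMfin : {a | ∃ G ∈ boxed T b, IsLexLead lexTie ω G a}.Finite :=
    (Set.finite_Icc 0 b).subset (by rintro a ⟨G, hG, h⟩; exact hG.2 a h.1)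
  set M : Finset (σ → ℤ) := hMfin.toFinset
  have hM : ∀ a, a ∈ M ↔ ∃ G ∈ boxed T b, IsLexLead lexTie ω G a := by simp [M]
  have hMlead : ∀ a ∈ M, ∃ G ∈ tilt (fun u => l * ω u) '' boxed T b, IsLead lexTie G a := by
    intro a ha
    obtain ⟨G, hG, h⟩ := (hM a).1 ha
    obtain ⟨G', hG', h'⟩ := hl₀ l hl b hb a G hG h
    exact ⟨_, ⟨G', hG', rfl⟩, h'⟩
  -- a leading exponent at `l` outside `M` would leave a nonzero member of the box avoiding `M`
  have hleadM : ∀ G ∈ boxed T b, ∀ a, IsLead lexTie (tilt (fun u => l * ω u) G) a → a ∈ M := by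
    intro G hG a ha
    by_contra haM
    obtain ⟨_, ⟨H, hH, rfl⟩, ⟨u, hu⟩, hvan⟩ := IsElim.exists_vanishing lexTie_injective M _ hTl
      (insert a M) (by rw [Finset.card_insert_of_notMem haM]; omega) (by
        intro c hc
        rcases Finset.mem_insert.1 hc with rfl | hc
        · exact ⟨_, ⟨G, hG, rfl⟩, ha⟩
        · exact hMlead c hc)
    obtain ⟨c, hc⟩ := exists_isLexLead lexTie_injective ω (hT.finite_support H hH.1)
      ⟨u, fun h => hu (tilt_eq_top_iff.2 h)⟩
    exact hc.1 (tilt_eq_top_iff.1 (hvan c ((hM c).2 ⟨H, hH, hc⟩)))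
  have hFlead : IsLead lexTie (tilt (fun u => l * ω u) F) e :=
    hmin.isLead
  have heM : e ∈ M := hleadM F hF e hFlead
  -- a member of the box whose support meets `M` in `e` alone
  obtain ⟨_, ⟨H, hH, rfl⟩, ⟨u, hu⟩, hvan⟩ := IsElim.exists_vanishing lexTie_injective (M.erase e) _
    hTl M (Finset.card_erase_lt_of_mem heM) hMlead
  have hHM : ∀ a ∈ M, H a ≠ ⊤ → a = e := by
    intro a ha hHa
    by_contra hae
    exact hHa (tilt_eq_top_iff.1 (hvan a (Finset.mem_erase.2 ⟨hae, ha⟩)))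
  obtain ⟨a, ha⟩ := exists_isLexLead lexTie_injective ω (hT.finite_support H hH.1)
      ⟨u, fun h => hu (tilt_eq_top_iff.2 h)⟩
  obtain rfl := hHM a ((hM a).2 ⟨H, hH, ha⟩) ha.1
  obtain ⟨c, hc⟩ := exists_isLead lexTie_injective (hfin H hH) ⟨u, hu⟩
  obtain rfl := hHM c (hleadM H hH c hc) (fun h => hc.1 (tilt_eq_top_iff.2 h))
  refine ⟨H, hH.1, ha.1, fun v hv hHv => ?_⟩
  rcases ha.2 v hv hHv with h1 | ⟨h1, h2 | ⟨h2, -⟩⟩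
  · exact Or.inl h1
  · exact Or.inr ⟨h1, h2⟩
  exfalso
  -- A tie in `H` between `c` and `v` is impossible: eliminating `c` between `H` and a multiple of
  -- `F` leaves a member whose leading value is still `r`, attained in the support of `H` off `c`,
  -- hence outside `M`.
  obtain ⟨r, hr⟩ := WithTop.ne_top_iff_exists.1 hc.1
  obtain ⟨d, hd, hdc⟩ := hTl.exists_normalized ⟨F, hF, rfl⟩ hFlead.1 r
  obtain ⟨_, ⟨K, hK, rfl⟩, hKc, hKv⟩ := hTl.elim _ ⟨H, hH, rfl⟩ _ hd c (by rw [← hr, hdc]) hc.1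
  have hFpos : ∀ w, w ≠ c → (r : WithTop ℝ) < tilt (fun u => l * ω u) F w + (d : WithTop ℝ) := by
    intro w hw
    rw [← hdc]
    exact (WithTop.add_lt_add_iff_right WithTop.coe_ne_top).2 (hmin.2 w hw)
  have hHr : ∀ w, (r : WithTop ℝ) ≤ tilt (fun u => l * ω u) H w := by
    intro w
    rw [hr]
    by_cases hw : w = c
    · rw [hw]
    · exact (hc.2 w hw).elim le_of_lt fun h => h.1.le
  have hHv' : tilt (fun u => l * ω u) H v = r := by
    rw [hr]; simp only [tilt, h1, h2]
  have hKv' : tilt (fun u => l * ω u) K v = r := by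
    have h3 := hFpos v hv
    have h4 := (hKv v).2 (by rw [hHv']; exact h3.ne)
    rwa [hHv', min_eq_left h3.le] at h4
  obtain ⟨p, hp⟩ := exists_isLead lexTie_injective (hfin K hK) ⟨v, by rw [hKv']; simp⟩
  have hpc : p ≠ c := fun h => hp.1 (by rw [h, hKc])
  have hKp : tilt (fun u => l * ω u) K p ≤ r := by
    rw [← hKv']
    by_cases hvp : v = p
    · rw [hvp]
    · exact (hp.2 v hvp).elim le_of_lt fun h => h.1.le
  have h5 : tilt (fun u => l * ω u) H p ≤ r := by
    rcases min_le_iff.1 ((hKv p).1.trans hKp) with h | h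
    · exact h
    · exact absurd (hFpos p hpc) h.not_gt
  exact hpc (hHM p (hleadM K hK p hp)
    (fun h => ((h5.trans_lt (WithTop.coe_lt_top r)).ne (tilt_eq_top_iff.2 h))))

end Stabilization

/-! ### Rows with a dominant entry -/

section Rows

/-- If every exponent of `W` is the strictly dominant entry of a row supported in `W`, with a
uniform margin `δ`, then elimination makes the values on `S ⊆ W` arbitrarily large, while the row
keeps its dominant entry at `e ∉ S`. -/
theorem IsElim.exists_large_on {α : Type*} {T : Set (α → WithTop ℝ)} (hT : IsElim T)
    (hfin : ∀ F ∈ T, {u | F u ≠ ⊤}.Finite) {W : Set α} {e : α} (he : e ∈ W) {δ : ℝ} (hδ : 0 < δ)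
    (hrow : ∀ q ∈ W, ∃ R ∈ T, R q = 0 ∧ (∀ u, R u ≠ ⊤ → u ∈ W) ∧ ∀ u, u ≠ q → (δ : WithTop ℝ) ≤ R u)
    {S : Set α} (hSW : S ⊆ W) (heS : e ∉ S) (K : ℝ) :
    ∃ H ∈ T, H e = 0 ∧ (∀ u, H u ≠ ⊤ → u ∈ W) ∧ (∀ u, u ≠ e → (δ : WithTop ℝ) ≤ H u) ∧
      ∀ u ∈ S, (K : WithTop ℝ) ≤ H u := by
  -- induction on the lower bound `k * δ` for the values on `S`
  have main : ∀ k : ℕ, ∃ H ∈ T, H e = 0 ∧ (∀ u, H u ≠ ⊤ → u ∈ W) ∧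
      (∀ u, u ≠ e → (δ : WithTop ℝ) ≤ H u) ∧ ∀ u ∈ S, ((k * δ : ℝ) : WithTop ℝ) ≤ H u := by
    intro k
    induction k with
    | zero =>
      obtain ⟨R, hR, hRe, hRW, hRδ⟩ := hrow e he
      refine ⟨R, hR, hRe, hRW, hRδ, fun u hu => ?_⟩
      refine le_trans ?_ (hRδ u fun h => heS (h ▸ hu))
      exact_mod_cast (by simpa using hδ.le)
    | succ k ih =>
      obtain ⟨H, hH, hHe, hHW, hHδ, hHS⟩ := ih
      have hsmall : ∀ F ∈ T, {u ∈ S | F u < (((k + 1 : ℕ) * δ : ℝ) : WithTop ℝ)}.Finite :=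
        fun F hF => (hfin F hF).subset fun u hu => hu.2.ne_top
      -- the terms on `S` of value less than `(k + 1) * δ` are removed one at a time
      induction hn : {u ∈ S | H u < (((k + 1 : ℕ) * δ : ℝ) : WithTop ℝ)}.ncard
        using Nat.strong_induction_on generalizing H with
      | _ n ihn =>
      subst hn
      by_cases hex : ∃ q ∈ S, H q < (((k + 1 : ℕ) * δ : ℝ) : WithTop ℝ)
      swap
      · push Not at hex
        exact ⟨H, hH, hHe, hHW, hHδ, hex⟩
      obtain ⟨q, hqS, hq⟩ := hex
      have hqe : q ≠ e := fun h => heS (h ▸ hqS)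
      obtain ⟨c, hc⟩ := WithTop.ne_top_iff_exists.1 hq.ne_top
      have hcδ : δ ≤ c := by have := hHδ q hqe; rw [← hc] at this; exact_mod_cast this
      have hck : k * δ ≤ c := by have := hHS q hqS; rw [← hc] at this; exact_mod_cast this
      obtain ⟨R, hR, hRq, hRW, hRδ⟩ := hrow q (hSW hqS)
      obtain ⟨H', hH', hH'q, hH'v⟩ := hT.elim H hH _ (hT.add_const R hR c) q
        (by simp [hRq, hc]) hq.ne_top
      have hRc : ∀ u, u ≠ q → ((δ + c : ℝ) : WithTop ℝ) ≤ R u + (c : WithTop ℝ) := by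
        intro u hu
        rw [WithTop.coe_add]
        exact add_le_add_left (hRδ u hu) _
      have hRc' : ∀ u, (c : WithTop ℝ) ≤ R u + (c : WithTop ℝ) := by
        intro u
        by_cases hu : u = q
        · simp [hu, hRq]
        · exact le_trans (by exact_mod_cast (by linarith)) (hRc u hu)
      refine ihn _ ?_ H' hH' ?_ ?_ ?_ ?_ rfl
      · refine Set.ncard_lt_ncard (Set.ssubset_iff_of_subset ?_ |>.2 ⟨q, ⟨hqS, hq⟩, ?_⟩) (hsmall H hH)
        · rintro u ⟨hu, huk⟩
          refine ⟨hu, ?_⟩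
          have huq : u ≠ q := by rintro rfl; simp [hH'q] at huk
          rcases min_lt_iff.1 ((hH'v u).1.trans_lt huk) with h | h
          · exact h
          · exfalso
            have h2 := (hRc u huq).trans_lt h
            have h3 : δ + c < ((k + 1 : ℕ) : ℝ) * δ := by exact_mod_cast h2
            push_cast at h3
            linarith
        · simp [hH'q]
      · have h1 : (0 : WithTop ℝ) < R e + (c : WithTop ℝ) :=
          lt_of_lt_of_le (by exact_mod_cast (by linarith)) (hRc e hqe.symm)
        rw [(hH'v e).2 (by rw [hHe]; exact h1.ne), hHe, min_eq_left h1.le]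
      · intro u hu
        rcases min_lt_iff.1 ((hH'v u).1.trans_lt (lt_top_iff_ne_top.2 hu)) with h | h
        · exact hHW u h.ne
        · exact hRW u fun h0 => h.ne (by simp [h0])
      · intro u hu
        refine le_trans (le_min (hHδ u hu) ?_) (hH'v u).1
        exact le_trans (by exact_mod_cast hcδ) (hRc' u)
      · intro u hu
        refine le_trans (le_min (hHS u hu) ?_) (hH'v u).1
        exact le_trans (by exact_mod_cast hck) (hRc' u)
  obtain ⟨k, hk⟩ := exists_nat_ge (K / δ)
  obtain ⟨H, hH, hHe, hHW, hHδ, hHS⟩ := main k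
  refine ⟨H, hH, hHe, hHW, hHδ, fun u hu => le_trans ?_ (hHS u hu)⟩
  rw [div_le_iff₀ hδ] at hk
  exact_mod_cast hk

lemma exists_pos_le_of_finite {α : Type*} {s : Set α} (hs : s.Finite) (f : α → ℝ)
    (hf : ∀ u ∈ s, 0 < f u) : ∃ δ > 0, ∀ u ∈ s, δ ≤ f u := by
  rcases s.eq_empty_or_nonempty with rfl | hne
  · exact ⟨1, one_pos, by simp⟩
  · obtain ⟨a, ha, hmin⟩ := Set.exists_min_image s f hs hne
    exact ⟨f a, hf a ha, hmin⟩

variable {σ : Type*}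

lemma exists_abs_apply_le {F : (σ → ℤ) → WithTop ℝ} (hF : {u | F u ≠ ⊤}.Finite) (x : σ) :
    ∃ D : ℕ, ∀ u, F u ≠ ⊤ → |u x| ≤ D := by
  obtain ⟨M, hM⟩ := (hF.image fun u => (u x).natAbs).bddAbove
  refine ⟨M, fun u hu => ?_⟩
  have := hM ⟨u, hu, rfl⟩
  rw [Int.abs_eq_natAbs]
  exact_mod_cast this

/-- The box has the prescribed width `2 * N` in the direction `x`. -/
lemma IsTropFamily.exists_box {T : Set ((σ → ℤ) → WithTop ℝ)} (hT : IsTropFamily T)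
    {F : (σ → ℤ) → WithTop ℝ} (hF : F ∈ T) {x : σ} {N : ℕ} (hN : ∀ u, F u ≠ ⊤ → |u x| ≤ N) :
    ∃ s b : σ → ℤ, s x = N ∧ b x = 2 * N ∧ (fun u => F (u - s)) ∈ boxed T b := by
  classical
  have hfin := hT.finite_support F hF
  obtain ⟨lo, hlo⟩ := hfin.bddBelow
  obtain ⟨hi, hhi⟩ := hfin.bddAbove
  refine ⟨Function.update (-lo) x N, Function.update (hi - lo) x (2 * N), by simp, by simp,
    hT.translate F hF _, fun u hu => ?_⟩
  have h1 := hlo hu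
  have h2 := hhi hu
  have h3 := abs_le.1 (hN _ hu)
  simp only [Pi.sub_apply, Function.update_self] at h3
  constructor <;> intro i <;> by_cases hi : i = x
  · subst hi
    simp only [Pi.zero_apply]
    linarith
  · have := h1 i
    simp only [Pi.sub_apply, Function.update_of_ne hi, Pi.neg_apply] at this
    simp only [Pi.zero_apply]
    linarith
  · subst hi
    simp only [Function.update_self]
    linarith
  · have := h2 i
    simp only [Pi.sub_apply, Function.update_of_ne hi, Pi.neg_apply] at this
    simp only [Function.update_of_ne hi, Pi.sub_apply]
    linarith

lemma IsUniqueMin.translate {ω : (σ → ℤ) → ℝ} {l : ℝ} {F : (σ → ℤ) → WithTop ℝ} {e s : σ → ℤ}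
    (hω : ∀ u v, ω (u + s) - ω u = ω (v + s) - ω v)
    (h : IsUniqueMin (tilt (fun u => l * ω u) F) e) :
    IsUniqueMin (tilt (fun u => l * ω u) fun u => F (u - s)) (e + s) := by
  refine ⟨?_, fun u hu => ?_⟩
  · rw [tilt_translate hω l F e, Ne, WithTop.add_eq_top, not_or]
    exact ⟨h.1, WithTop.coe_ne_top⟩
  obtain ⟨v, rfl⟩ : ∃ v, u = v + s := ⟨u - s, by simp⟩
  rw [tilt_translate hω l F e, tilt_translate hω l F e,
    WithTop.add_lt_add_iff_right WithTop.coe_ne_top]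
  exact h.2 v fun h => hu (by rw [h])

lemma IsTropFamily.exists_translate_normalized {T : Set ((σ → ℤ) → WithTop ℝ)}
    (hT : IsTropFamily T) {F : (σ → ℤ) → WithTop ℝ} (hF : F ∈ T) {e : σ → ℤ} (he : F e ≠ ⊤) :
    ∃ c : ℝ, (fun u => F (u + e) + (c : WithTop ℝ)) ∈ T ∧ F e + (c : WithTop ℝ) = 0 := by
  have h := hT.translate F hF (-e)
  simp only [sub_neg_eq_add] at h
  obtain ⟨c, hc, hc0⟩ := hT.exists_normalized h (e := 0) (by simpa using he) 0
  exact ⟨c, hc, by simpa using hc0⟩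

/-- `G` is normalized at `0`, its support has degree at most `D` in absolute value in the variable
`x`, and at slope `a` in `x` all its other terms exceed the one at `0` by at least `δ`. -/
def IsRow (x : σ) (δ : ℝ) (D : ℕ) (a : ℝ) (G : (σ → ℤ) → WithTop ℝ) : Prop :=
  G 0 = 0 ∧ ∀ u, u ≠ 0 → ∀ r : ℝ, G u = r → |u x| ≤ D ∧ δ ≤ r + a * u x

lemma IsRow.mono {x : σ} {δ δ' a : ℝ} {D D' : ℕ} {G : (σ → ℤ) → WithTop ℝ}
    (h : IsRow x δ D a G) (hδ : δ' ≤ δ) (hD : D ≤ D') : IsRow x δ' D' a G :=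
  ⟨h.1, fun u hu r hr => ⟨(h.2 u hu r hr).1.trans (by exact_mod_cast hD),
    hδ.trans (h.2 u hu r hr).2⟩⟩

/-- A unique minimum at slope `a` persists, with a uniform margin, at the nearby slopes. -/
lemma exists_isRow_nhds {T : Set ((σ → ℤ) → WithTop ℝ)} (hT : IsTropFamily T) {x : σ} {a : ℝ}
    {F : (σ → ℤ) → WithTop ℝ} (hF : F ∈ T) {e : σ → ℤ}
    (he : IsUniqueMin (tilt (fun u => a * u x) F) e) :
    ∃ δ > 0, ∃ D : ℕ, ∃ G ∈ T, ∀ᶠ a' in nhds a, IsRow x δ D a' G := by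
  obtain ⟨c, hG, hGe⟩ := hT.exists_translate_normalized hF
    (show F e ≠ ⊤ from fun h => he.1 (tilt_eq_top_iff.2 h))
  set G := fun u => F (u + e) + (c : WithTop ℝ) with hGdef
  have hG0 : G 0 = 0 := by simpa [G] using hGe
  have hfin := hT.finite_support G hG
  have hpos : ∀ u, u ≠ 0 → ∀ r : ℝ, G u = r → 0 < r + a * u x := by
    intro u hu r hr
    have h1 := he.2 (u + e) (by simpa using hu)
    obtain ⟨y, hy⟩ := WithTop.ne_top_iff_exists.1
      (show F e ≠ ⊤ from fun h => he.1 (tilt_eq_top_iff.2 h))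
    obtain ⟨z, hz⟩ := WithTop.ne_top_iff_exists.1
      (show F (u + e) ≠ ⊤ from fun h => by simp [hGdef, h] at hr)
    simp only [hGdef, ← hz, ← WithTop.coe_add, WithTop.coe_inj] at hr
    simp only [← hy, ← WithTop.coe_add] at hGe
    have hGe' : y + c = 0 := by exact_mod_cast hGe
    simp only [tilt, ← hy, ← hz, ← WithTop.coe_add, WithTop.coe_lt_coe, Pi.add_apply,
      Int.cast_add] at h1
    linarith
  obtain ⟨D, hD⟩ := exists_abs_apply_le hfin x
  obtain ⟨δ, hδ, hδle⟩ := exists_pos_le_of_finite (s := {u | G u ≠ ⊤ ∧ u ≠ 0})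
    (hfin.subset fun u hu => hu.1) (fun u => (G u).untopD 0 + a * u x) (by
      rintro u ⟨hu, hu0⟩
      obtain ⟨r, hr⟩ := WithTop.ne_top_iff_exists.1 hu
      simpa [← hr] using hpos u hu0 r hr.symm)
  refine ⟨δ / 2, half_pos hδ, D, G, hG, ?_⟩
  have hnear : ∀ᶠ a' in nhds a, |a' - a| * D < δ / 2 := by
    have hcont : Filter.Tendsto (fun a' : ℝ => |a' - a| * D) (nhds a) (nhds (|a - a| * D)) :=
      (by fun_prop : Continuous fun a' : ℝ => |a' - a| * D).tendsto a
    exact hcont.eventually (gt_mem_nhds (by simpa using hδ))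
  filter_upwards [hnear] with a' ha'
  refine ⟨hG0, fun u hu r hr => ?_⟩
  have hu' : G u ≠ ⊤ := by simp [hr]
  refine ⟨hD u hu', ?_⟩
  have h1 := hδle u ⟨hu', hu⟩
  simp only [hr, WithTop.untopD_coe] at h1
  have h2 : |(u x : ℝ)| ≤ D := by exact_mod_cast hD u hu'
  have h3 : |(a' - a) * u x| ≤ |a' - a| * D := by
    rw [abs_mul]; exact mul_le_mul_of_nonneg_left h2 (abs_nonneg _)
  have h4 := (abs_le.1 h3).1
  nlinarith

lemma exists_isRow_Icc {T : Set ((σ → ℤ) → WithTop ℝ)} (hT : IsTropFamily T) {x : σ}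
    (h : ∀ a : ℝ, ∃ F ∈ T, ∃ e, IsUniqueMin (tilt (fun u => a * u x) F) e) (A B : ℝ) :
    ∃ δ > 0, ∃ D : ℕ, ∀ a ∈ Set.Icc A B, ∃ G ∈ T, IsRow x δ D a G := by
  refine (isCompact_Icc (a := A) (b := B)).induction_on
    (p := fun s => ∃ δ > 0, ∃ D : ℕ, ∀ a ∈ s, ∃ G ∈ T, IsRow x δ D a G) ?_ ?_ ?_ ?_
  · exact ⟨1, one_pos, 0, by simp⟩
  · rintro s t hst ⟨δ, hδ, D, h1⟩
    exact ⟨δ, hδ, D, fun a ha => h1 a (hst ha)⟩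
  · rintro s t ⟨δ, hδ, D, h1⟩ ⟨δ', hδ', D', h1'⟩
    refine ⟨min δ δ', lt_min hδ hδ', max D D', ?_⟩
    rintro a (ha | ha)
    · obtain ⟨G, hG, hr⟩ := h1 a ha
      exact ⟨G, hG, hr.mono (min_le_left _ _) (le_max_left _ _)⟩
    · obtain ⟨G, hG, hr⟩ := h1' a ha
      exact ⟨G, hG, hr.mono (min_le_right _ _) (le_max_right _ _)⟩
  · intro a _
    obtain ⟨F, hF, e, he⟩ := h a
    obtain ⟨δ, hδ, D, G, hG, hev⟩ := exists_isRow_nhds hT hF he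
    exact ⟨_, mem_nhdsWithin_of_mem_nhds hev, δ, hδ, D, fun a' ha' => ⟨G, hG, ha'⟩⟩

variable [Fintype σ]

/-- One member, with support on one side of the hyperplane `x = 0`, is a row for all slopes `a`
with `c * a` large. Here `c` is `1` or `-1`. -/
lemma exists_isRow_of_large {T : Set ((σ → ℤ) → WithTop ℝ)} (hT : IsTropFamily T) {x : σ} {c : ℤ}
    (hc : c * c = 1)
    (h : ∀ a : ℝ, ∃ F ∈ T, ∃ e, IsUniqueMin (tilt (fun u => a * u x) F) e) :
    ∃ δ > 0, ∃ D : ℕ, ∃ A : ℝ, ∃ G ∈ T, (∀ u, G u ≠ ⊤ → 0 ≤ c * u x) ∧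
      ∀ a, A ≤ c * a → IsRow x δ D a G := by
  obtain ⟨l, hl⟩ := exists_lex_min_of_unique_min hT Set.univ (fun u => (c : ℝ) * u x)
    (by intros; simp; ring)
  obtain ⟨F, hF, e, he⟩ := h (l * c)
  have he' : IsUniqueMin (tilt (fun u => l * ((c : ℝ) * u x)) F) e := by
    simpa only [mul_assoc] using he
  obtain ⟨N, hN⟩ := exists_abs_apply_le (hT.finite_support F hF) x
  obtain ⟨s, b, -, -, hbox⟩ := hT.exists_box hF hN
  obtain ⟨H, hH, hHe, hlex⟩ := hl l le_rfl b trivial (e + s) _ hbox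
    (he'.translate (by intros; simp; ring))
  obtain ⟨d, hG, hd⟩ := hT.exists_translate_normalized hH hHe
  set G := fun u => H (u + (e + s)) + (d : WithTop ℝ) with hGdef
  have hG0 : G 0 = 0 := by simpa [G] using hd
  have hfin := hT.finite_support G hG
  have key : ∀ u, u ≠ 0 → ∀ r : ℝ, G u = r → 0 < c * u x ∨ u x = 0 ∧ 0 < r := by
    intro u hu r hr
    have hHu : H (u + (e + s)) ≠ ⊤ := fun h => by simp [hGdef, h] at hr
    have h1 := hlex (u + (e + s)) (by simpa using hu) hHu
    rcases h1 with h1 | ⟨h1, h2⟩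
    · left
      have h3 : c * (e + s) x < c * (u + (e + s)) x := by exact_mod_cast h1
      simp only [Pi.add_apply] at h3
      linarith
    · right
      have h3 : c * (e + s) x = c * (u + (e + s)) x := by exact_mod_cast h1
      simp only [Pi.add_apply] at h3
      constructor
      · have h4 : c * u x = 0 := by linarith
        have : c ≠ 0 := by rintro rfl; simp at hc
        simpa [this] using h4
      · have h4 := (WithTop.add_lt_add_iff_right (WithTop.coe_ne_top (a := d))).2 h2
        rw [hd, show H (u + (e + s)) + (d : WithTop ℝ) = r from hr] at h4
        exact_mod_cast h4
  obtain ⟨D, hD⟩ := exists_abs_apply_le hfin x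
  obtain ⟨δ, hδ, hδle⟩ := exists_pos_le_of_finite (s := {u | G u ≠ ⊤ ∧ u ≠ 0 ∧ u x = 0})
    (hfin.subset fun u hu => hu.1) (fun u => (G u).untopD 0) (by
      rintro u ⟨hu, hu0, hux⟩
      obtain ⟨r, hr⟩ := WithTop.ne_top_iff_exists.1 hu
      have := key u hu0 r hr.symm
      simpa [hux, ← hr] using this)
  obtain ⟨A, hA⟩ := (hfin.image fun u => δ - (G u).untopD 0).bddAbove
  refine ⟨δ, hδ, D, max A 0, G, hG, ?_, ?_⟩
  · intro u hu
    by_cases hu0 : u = 0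
    · simp [hu0]
    obtain ⟨r, hr⟩ := WithTop.ne_top_iff_exists.1 hu
    rcases key u hu0 r hr.symm with h1 | ⟨h1, -⟩
    · exact h1.le
    · simp [h1]
  · intro a ha
    refine ⟨hG0, fun u hu r hr => ?_⟩
    have hu' : G u ≠ ⊤ := by simp [hr]
    refine ⟨hD u hu', ?_⟩
    rcases key u hu r hr with h1 | ⟨h1, h2⟩
    · have h3 : (1 : ℝ) ≤ c * u x := by exact_mod_cast h1
      have h4 : δ - r ≤ A := by simpa [hr] using hA ⟨u, hu', rfl⟩
      have h5 : a * u x = (c * a) * (c * u x) := by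
        have : (c : ℝ) * c = 1 := by exact_mod_cast hc
        linear_combination (-a * u x) * this
      have h6 : 0 ≤ (c : ℝ) * a := (le_max_right _ _).trans ha
      have h7 : A ≤ (c : ℝ) * a := (le_max_left _ _).trans ha
      rw [h5]
      nlinarith
    · have h3 := hδle u ⟨hu', hu, h1⟩
      simp only [hr, WithTop.untopD_coe] at h3
      simpa [h1] using h3

end Rows

/-! ### Eliminating one variable -/

section OneVariable

variable {σ : Type*} [Fintype σ]

/-- Rows for all slopes with uniform constants; for slopes close to `± ∞` their supports are
one-sided. -/
lemma exists_forall_isRow {T : Set ((σ → ℤ) → WithTop ℝ)} (hT : IsTropFamily T) {x : σ}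
    (h : ∀ a : ℝ, ∃ F ∈ T, ∃ e, IsUniqueMin (tilt (fun u => a * u x) F) e) :
    ∃ δ > 0, ∃ D : ℕ, ∃ A : ℝ, ∀ a, ∃ G ∈ T, IsRow x δ D a G ∧
      (A < a → ∀ u, G u ≠ ⊤ → 0 ≤ u x) ∧ (a < -A → ∀ u, G u ≠ ⊤ → u x ≤ 0) := by
  obtain ⟨δ₁, hδ₁, D₁, A₁, G₁, hG₁, hs₁, hr₁⟩ := exists_isRow_of_large hT (c := 1) (by simp) h
  obtain ⟨δ₂, hδ₂, D₂, A₂, G₂, hG₂, hs₂, hr₂⟩ := exists_isRow_of_large hT (c := -1) (by simp) h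
  set A := max 0 (max A₁ A₂)
  have hA₁ : A₁ ≤ A := (le_max_left _ _).trans (le_max_right _ _)
  have hA₂ : A₂ ≤ A := (le_max_right _ _).trans (le_max_right _ _)
  have hA₀ : 0 ≤ A := le_max_left _ _
  obtain ⟨δ₃, hδ₃, D₃, hr₃⟩ := exists_isRow_Icc hT h (-A) A
  refine ⟨min δ₁ (min δ₂ δ₃), lt_min hδ₁ (lt_min hδ₂ hδ₃), max D₁ (max D₂ D₃), A, fun a => ?_⟩
  rcases lt_or_ge A a with ha | ha
  · refine ⟨G₁, hG₁, (hr₁ a (by push_cast; linarith)).mono (min_le_left _ _) (le_max_left _ _),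
      fun _ u hu => by simpa using hs₁ u hu, fun h => by linarith⟩
  rcases lt_or_ge a (-A) with ha' | ha'
  · refine ⟨G₂, hG₂, (hr₂ a (by push_cast; linarith)).mono
      ((min_le_right _ _).trans (min_le_left _ _)) ((le_max_left _ _).trans (le_max_right _ _)),
      fun h => by linarith, fun _ u hu => by simpa using hs₂ u hu⟩
  · obtain ⟨G, hG, hr⟩ := hr₃ a ⟨ha', ha⟩
    exact ⟨G, hG, hr.mono ((min_le_right _ _).trans (min_le_right _ _))
      ((le_max_right _ _).trans (le_max_right _ _)), fun h => by linarith, fun h => by linarith⟩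

/-- The width `N` does not depend on the bound `K`. -/
lemma exists_large_off_hyperplane {T : Set ((σ → ℤ) → WithTop ℝ)} (hT : IsTropFamily T) {x : σ}
    (h : ∀ a : ℝ, ∃ F ∈ T, ∃ e, IsUniqueMin (tilt (fun u => a * u x) F) e) :
    ∃ N : ℕ, ∀ K : ℝ, ∃ H ∈ T, H 0 = 0 ∧ (∀ u, H u ≠ ⊤ → |u x| ≤ N) ∧ (∀ u, u ≠ 0 → 0 < H u) ∧
      ∀ u, u x ≠ 0 → (K : WithTop ℝ) ≤ H u := by
  obtain ⟨δ, hδ, D, A, hrow⟩ := exists_forall_isRow hT h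
  -- the curvature of the potential costs at most half of the margin within the degree bound
  obtain ⟨ε, hε, hεD⟩ : ∃ ε > 0, ε * D ^ 2 ≤ δ / 2 := by
    refine ⟨δ / 2 / (D ^ 2 + 1), by positivity, ?_⟩
    rw [div_mul_eq_mul_div, div_le_iff₀ (by positivity)]
    nlinarith
  -- within distance `D` of the boundary of the strip the slopes are so large that the rows are
  -- one-sided and point into the strip
  obtain ⟨N, hN⟩ := exists_nat_gt (A / (2 * ε) + D)
  refine ⟨N, fun K => ?_⟩
  set ψ : (σ → ℤ) → ℝ := fun u => -(ε * (u x) ^ 2) with hψ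
  have hNA : ∀ q : ℝ, N < q + D → A < 2 * ε * q := by
    intro q hq
    have : A / (2 * ε) < q := by linarith
    rw [div_lt_iff₀ (by positivity)] at this
    linarith
  have hfin : ∀ F ∈ tilt ψ '' T, {u | F u ≠ ⊤}.Finite := by
    rintro _ ⟨F, hF, rfl⟩
    simpa [tilt_eq_top_iff] using hT.finite_support F hF
  obtain ⟨_, ⟨H, hH, rfl⟩, hH0, hHW, hHδ, hHS⟩ := (hT.toIsElim.tilt ψ).exists_large_on hfin
    (W := {u | |u x| ≤ N}) (e := 0) (by simp) (half_pos hδ) (by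
      intro q hq
      -- the slope of the potential at `q` is `-2 * ε * q x`
      obtain ⟨G, hG, ⟨hG0, hGr⟩, hpos, hneg⟩ := hrow (-(2 * ε * q x))
      have hGt := hT.add_const _ (hT.translate G hG q) (ε * (q x) ^ 2)
      refine ⟨_, ⟨_, hGt, rfl⟩, ?_, ?_, ?_⟩
      · simp only [tilt, sub_self, hG0, zero_add, hψ]
        rw [← WithTop.coe_add]
        simp
      · intro u hu
        have hGu : G (u - q) ≠ ⊤ := fun h => hu (by simp [tilt, h])
        by_cases huq : u - q = 0
        · rw [sub_eq_zero] at huq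
          exact huq ▸ hq
        obtain ⟨r, hr⟩ := WithTop.ne_top_iff_exists.1 hGu
        have h1 := abs_le.1 (hGr _ huq r hr.symm).1
        simp only [Pi.sub_apply] at h1
        have hq' := abs_le.1 (show |q x| ≤ (N : ℤ) from hq)
        change |u x| ≤ (N : ℤ)
        refine abs_le.2 ⟨?_, ?_⟩
        · by_contra! hlt
          have h2 : (N : ℝ) < -(q x : ℝ) + D := by
            have : (N : ℤ) < -(q x) + D := by linarith
            exact_mod_cast this
          have h3 := hpos (by linarith [hNA _ h2]) _ hGu
          simp only [Pi.sub_apply] at h3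
          linarith
        · by_contra! hlt
          have h2 : (N : ℝ) < (q x : ℝ) + D := by
            have : (N : ℤ) < q x + D := by linarith
            exact_mod_cast this
          have h3 := hneg (by linarith [hNA _ h2]) _ hGu
          simp only [Pi.sub_apply] at h3
          linarith
      · intro u hu
        by_cases hGu : G (u - q) = ⊤
        · simp [tilt, hGu]
        obtain ⟨r, hr⟩ := WithTop.ne_top_iff_exists.1 hGu
        obtain ⟨h1, h2⟩ := hGr _ (sub_ne_zero.2 hu) r hr.symm
        have h3 : ((u x - q x : ℤ) : ℝ) ^ 2 ≤ (D : ℝ) ^ 2 := by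
          have : |((u x - q x : ℤ) : ℝ)| ≤ D := by exact_mod_cast h1
          exact sq_le_sq' (abs_le.1 this).1 (abs_le.1 this).2
        simp only [tilt, ← hr, ← WithTop.coe_add, WithTop.coe_le_coe, hψ]
        simp only [Pi.sub_apply] at h2
        push_cast at h2 h3
        nlinarith [mul_le_mul_of_nonneg_left h3 hε.le])
    (S := {u | u x ≠ 0 ∧ |u x| ≤ N}) (fun u hu => hu.2) (by simp) K
  have hle : ∀ u, tilt ψ H u ≤ H u := by
    intro u
    have : ((ψ u : ℝ) : WithTop ℝ) ≤ 0 := by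
      have : ψ u ≤ 0 := by simp only [hψ]; nlinarith [sq_nonneg (u x : ℝ)]
      exact_mod_cast this
    exact add_le_of_nonpos_right this
  refine ⟨H, hH, by simpa [tilt, hψ] using hH0, fun u hu => hHW u (by rwa [Ne, tilt_eq_top_iff]),
    fun u hu => ?_, fun u hu => ?_⟩
  · exact lt_of_lt_of_le (by exact_mod_cast half_pos hδ) ((hHδ u hu).trans (hle u))
  · by_cases hHu : H u = ⊤
    · simp [hHu]
    · exact (hHS u ⟨hu, hHW u (by rwa [Ne, tilt_eq_top_iff])⟩).trans (hle u)

/-- Elimination of one variable: if for every slope `a` in the variable `x` some member of the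
tilted family has a unique minimum, then so does a member of the original family that is homogeneous
in `x`. -/
theorem exists_homogeneous_unique_min {T : Set ((σ → ℤ) → WithTop ℝ)} (hT : IsTropFamily T) {x : σ}
    (h : ∀ a : ℝ, ∃ F ∈ T, ∃ e, IsUniqueMin (tilt (fun u => a * u x) F) e) :
    ∃ F ∈ T, (∀ u v, F u ≠ ⊤ → F v ≠ ⊤ → u x = v x) ∧ ∃ e, IsUniqueMin F e := by
  obtain ⟨N, hN⟩ := exists_large_off_hyperplane hT h
  -- after translation by `s` with `s x = N` the hyperplane `x = 0` becomes `x = N`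
  set ω : (σ → ℤ) → ℝ := fun u => if u x = N then 0 else -1 with hωdef
  obtain ⟨l, hl⟩ := exists_lex_min_of_unique_min hT {b | b x = 2 * N} ω (by
    intro b hb b' hb' s hs hbs
    have hsx : s x = 0 := by
      have h1 : 0 ≤ s x := hs x
      have h2 : b x + s x ≤ b' x := hbs x
      have h3 : b x = 2 * N := hb
      have h4 : b' x = 2 * N := hb'
      linarith
    simp [ω, hsx])
  set L := max l 0
  obtain ⟨H, hH, hH0, hHN, hHpos, hHK⟩ := hN (L + 1)
  obtain ⟨s, b, hs, hb, hbox⟩ := hT.exists_box hH hHN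
  obtain ⟨F, hF, hFs, hlex⟩ := hl L (le_max_left _ _) b hb s _ hbox (by
    have hωs : ω s = 0 := by simp [ω, hs]
    refine ⟨by simp [tilt, hH0, hωs], fun u hu => ?_⟩
    simp only [tilt, sub_self, hH0, hωs, mul_zero, WithTop.coe_zero, add_zero]
    by_cases hux : u x = N
    · simpa [ω, hux] using hHpos (u - s) (sub_ne_zero.2 hu)
    · have h1 := hHK (u - s) (by simpa [hs, sub_eq_zero] using hux)
      simp only [ω, hux, if_false]
      refine lt_of_lt_of_le ?_ (add_le_add_left h1 _)
      rw [← WithTop.coe_add]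
      exact_mod_cast (by linarith : (0 : ℝ) < L + 1 + L * (-1)))
  have hsupp : ∀ u, F u ≠ ⊤ → u x = N := by
    intro u hu
    by_cases hus : u = s
    · rw [hus, hs]
    by_contra hux
    have := hlex u hus hu
    simp only [ω, hs, hux, if_true, if_false] at this
    norm_num at this
  refine ⟨F, hF, fun u v hu hv => (hsupp u hu).trans (hsupp v hv).symm, s, hFs, fun u hu => ?_⟩
  by_cases hFu : F u = ⊤
  · rw [hFu]; exact lt_top_iff_ne_top.2 hFs
  · have := hlex u hu hFu
    simpa [ω, hs, hsupp u hFu] using this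

end OneVariable

/-! ### Several variables, and the elimination ideal -/

section Final

/-- Members homogeneous in given variables form a family closed under elimination because two
members that are to be eliminated at `u` both have `u` in their supports. -/
lemma IsTropFamily.homogeneous {σ : Type*} {T : Set ((σ → ℤ) → WithTop ℝ)} (hT : IsTropFamily T)
    (X : Set σ) :
    IsTropFamily {F ∈ T | ∀ i ∈ X, ∀ u v, F u ≠ ⊤ → F v ≠ ⊤ → u i = v i} where
  add_const := fun F hF c => ⟨hT.add_const F hF.1 c, fun i hi u v hu hv =>
    hF.2 i hi u v (by simpa using hu) (by simpa using hv)⟩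
  elim := by
    rintro F ⟨hF, hFX⟩ G ⟨hG, hGX⟩ u h hne
    obtain ⟨H, hH, hHu, hHv⟩ := hT.elim F hF G hG u h hne
    -- both supports contain `u`
    have key : ∀ i ∈ X, ∀ v, H v ≠ ⊤ → v i = u i := by
      intro i hi v hv
      rcases min_lt_iff.1 ((hHv v).1.trans_lt (lt_top_iff_ne_top.2 hv)) with h1 | h1
      · exact hFX i hi v u h1.ne hne
      · exact hGX i hi v u h1.ne (h ▸ hne)
    exact ⟨H, ⟨hH, fun i hi v w hv hw => (key i hi v hv).trans (key i hi w hw).symm⟩, hHu, hHv⟩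
  finite_support := fun F hF => hT.finite_support F hF.1
  translate := fun F hF s => ⟨hT.translate F hF.1 s, fun i hi u v hu hv => by
    simpa using hF.2 i hi _ _ hu hv⟩

lemma IsTropFamily.tilt {σ : Type*} {T : Set ((σ → ℤ) → WithTop ℝ)} (hT : IsTropFamily T)
    {ρ : (σ → ℤ) → ℝ} (hρ : ∀ u v, ρ (u - v) = ρ u - ρ v) : IsTropFamily (tilt ρ '' T) where
  toIsElim := hT.toIsElim.tilt ρ
  finite_support := by
    rintro _ ⟨F, hF, rfl⟩
    simpa [tilt_eq_top_iff] using hT.finite_support F hF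
  translate := by
    rintro _ ⟨F, hF, rfl⟩ s
    refine ⟨_, hT.add_const _ (hT.translate F hF s) (-ρ s), ?_⟩
    funext u
    simp only [TropLaurent.tilt]
    rw [add_assoc, ← WithTop.coe_add, hρ]
    congr 2
    ring

variable {σ : Type*} [Fintype σ]

/-- The linear form `u ↦ u ⋅ w` on exponent vectors. -/
noncomputable def linearForm (w : σ → ℝ) (u : σ → ℤ) : ℝ := ∑ i, (u i : ℝ) * w i

lemma linearForm_sub (w : σ → ℝ) (u v : σ → ℤ) :
    linearForm w (u - v) = linearForm w u - linearForm w v := by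
  simp [linearForm, sub_mul, Finset.sum_sub_distrib]

lemma linearForm_add_left (w w' : σ → ℝ) (u : σ → ℤ) :
    linearForm (w + w') u = linearForm w u + linearForm w' u := by
  simp [linearForm, mul_add, Finset.sum_add_distrib]

lemma tilt_tilt {α : Type*} (ρ ρ' : α → ℝ) (F : α → WithTop ℝ) :
    tilt ρ' (tilt ρ F) = tilt (ρ + ρ') F := by
  funext u
  simp [tilt, add_assoc]

/-- Elimination of the variables in `X`: if no member homogeneous in the variables of `X` has a
unique minimum, then some point `a` supported on `X` has the property that no member of the family
tilted by `a` has a unique minimum. -/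
theorem exists_forall_not_isUniqueMin (X : Finset σ) :
    ∀ T : Set ((σ → ℤ) → WithTop ℝ), IsTropFamily T →
      (∀ F ∈ T, (∀ i ∈ X, ∀ u v, F u ≠ ⊤ → F v ≠ ⊤ → u i = v i) → ¬∃ e, IsUniqueMin F e) →
      ∃ a : σ → ℝ, (∀ i ∉ X, a i = 0) ∧
        ∀ F ∈ T, ¬∃ e, IsUniqueMin (tilt (linearForm a) F) e := by
  classical
  induction X using Finset.induction_on with
  | empty =>
    intro T _ h
    refine ⟨0, by simp, fun F hF => ?_⟩
    have : tilt (linearForm 0) F = F := by funext u; simp [tilt, linearForm]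
    rw [this]
    exact h F hF (by simp)
  | insert x X hx ih =>
    intro T hT h
    obtain ⟨c, hc⟩ : ∃ c : ℝ, ∀ F ∈ {F ∈ T | ∀ i ∈ (X : Set σ), ∀ u v, F u ≠ ⊤ → F v ≠ ⊤ →
        u i = v i}, ¬∃ e, IsUniqueMin (tilt (fun u => c * u x) F) e := by
      by_contra! hcon
      obtain ⟨F, ⟨hF, hFX⟩, hFx, he⟩ := exists_homogeneous_unique_min (hT.homogeneous X) hcon
      refine h F hF (fun i hi => ?_) he
      rcases Finset.mem_insert.1 hi with rfl | hi
      · exact hFx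
      · exact hFX i hi
    have hlin : linearForm (Pi.single x c) = fun u : σ → ℤ => c * u x := by
      funext u
      simp [linearForm, Pi.single_apply, mul_comm]
    obtain ⟨a, ha, haT⟩ := ih _ (hT.tilt (linearForm_sub (Pi.single x c))) (by
      rintro _ ⟨F, hF, rfl⟩ hX
      rw [hlin]
      exact hc F ⟨hF, fun i hi u v hu hv => hX i hi u v (by rwa [Ne, tilt_eq_top_iff])
        (by rwa [Ne, tilt_eq_top_iff])⟩)
    refine ⟨Pi.single x c + a, fun i hi => ?_, fun F hF => ?_⟩
    · rw [Finset.mem_insert, not_or] at hi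
      simp [hi.1, ha i hi.2]
    · have h1 := haT _ ⟨F, hF, rfl⟩
      rw [tilt_tilt] at h1
      have h2 : linearForm (Pi.single x c) + linearForm a = linearForm (Pi.single x c + a) := by
        funext u
        rw [linearForm_add_left]; rfl
      rwa [h2] at h1

/-- The coefficients of `f` as elements of `ℝ ∪ {∞}`, without the tropical operations. -/
noncomputable def coeffFun {σ : Type*} (f : TropLaurent σ) (u : σ → ℤ) : WithTop ℝ := Tropical.untrop (f.coeff u)

lemma coeffFun_eq_top_iff {σ : Type*} {f : TropLaurent σ} {u : σ → ℤ} :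
    coeffFun f u = ⊤ ↔ f.coeff u = 0 := by
  rw [← Tropical.untrop_inj_iff]
  rfl

lemma isTropFamily_coeffFun {σ : Type*} {I : Ideal (TropLaurent σ)} (hI : IsTropicalIdeal I) :
    IsTropFamily (coeffFun '' (I : Set (TropLaurent σ))) := by
  have hmul : ∀ (f : TropLaurent σ) (s : σ → ℤ) (c : ℝ) (u : σ → ℤ),
      coeffFun (AddMonoidAlgebra.single s (Tropical.trop (c : WithTop ℝ)) * f) u =
        c + coeffFun f (u - s) := by
    intro f s c u
    simp only [coeffFun]
    rw [AddMonoidAlgebra.coeff_single_mul_apply, Tropical.untrop_mul, Tropical.untrop_trop,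
      neg_add_eq_sub]
  refine ⟨⟨?_, ?_⟩, ?_, ?_⟩
  · rintro _ ⟨f, hf, rfl⟩ c
    refine ⟨_, I.mul_mem_left (AddMonoidAlgebra.single 0 (Tropical.trop (c : WithTop ℝ))) hf, ?_⟩
    funext u
    rw [hmul, sub_zero, add_comm]
  · rintro _ ⟨f, hf, rfl⟩ _ ⟨g, hg, rfl⟩ u h hne
    obtain ⟨k, hk, hku, hkv⟩ := hI f hf g hg u (Tropical.untrop_injective h)
      (fun h0 => hne (coeffFun_eq_top_iff.2 h0))
    refine ⟨_, ⟨k, hk, rfl⟩, coeffFun_eq_top_iff.2 hku, fun v => ⟨?_, fun hv => ?_⟩⟩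
    · exact Tropical.untrop_le_iff.2 (hkv v).1
    · have := (hkv v).2 fun h0 => hv (by simp only [coeffFun, h0])
      simp only [coeffFun, this, Tropical.untrop_add]
  · rintro _ ⟨f, -, rfl⟩
    refine f.coeff.support.finite_toSet.subset fun u hu => ?_
    simpa using fun h => hu (coeffFun_eq_top_iff.2 h)
  · rintro _ ⟨f, hf, rfl⟩ s
    refine ⟨_, I.mul_mem_left (AddMonoidAlgebra.single s (Tropical.trop ((0 : ℝ) : WithTop ℝ))) hf,
      ?_⟩
    funext u
    rw [hmul, WithTop.coe_zero, zero_add]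

lemma untrop_termValue (f : TropLaurent σ) (w : σ → ℝ) (u : σ → ℤ) :
    Tropical.untrop (termValue f w u) = tilt (linearForm w) (coeffFun f) u := rfl

lemma untrop_eval_le (f : TropLaurent σ) (w : σ → ℝ) (u : σ → ℤ) :
    Tropical.untrop (eval f w) ≤ tilt (linearForm w) (coeffFun f) u := by
  rw [eval, Finset.untrop_sum']
  by_cases hu : u ∈ f.coeff.support
  · exact Finset.inf_le hu
  · have : tilt (linearForm w) (coeffFun f) u = ⊤ := by
      rw [tilt_eq_top_iff, coeffFun_eq_top_iff]
      simpa using hu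
    rw [this]
    exact le_top

lemma untrop_eval_eq {f : TropLaurent σ} {w : σ → ℝ} {e : σ → ℤ}
    (he : ∀ u, tilt (linearForm w) (coeffFun f) e ≤ tilt (linearForm w) (coeffFun f) u) :
    Tropical.untrop (eval f w) = tilt (linearForm w) (coeffFun f) e := by
  refine le_antisymm (untrop_eval_le f w e) ?_
  rw [eval, Finset.untrop_sum']
  exact Finset.le_inf fun u _ => he u

lemma mem_variety_iff {I : Ideal (TropLaurent σ)} {w : σ → ℝ} :
    w ∈ variety I ↔ ∀ f ∈ I, ¬∃ e, IsUniqueMin (tilt (linearForm w) (coeffFun f)) e := by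
  refine forall₂_congr fun f _ => ⟨?_, fun h => ?_⟩
  · rintro h ⟨e, he, hmin⟩
    have hle : ∀ u, tilt (linearForm w) (coeffFun f) e ≤ tilt (linearForm w) (coeffFun f) u :=
      fun u => by
        by_cases hu : u = e
        · rw [hu]
        · exact (hmin u hu).le
    have hev := untrop_eval_eq hle
    rcases h with h | ⟨u, v, huv, hu, hv⟩
    · rw [h] at hev
      exact he hev.symm
    · have hother : ∀ u, u ≠ e → termValue f w u ≠ eval f w := fun u hu h => by
        have h1 := hmin u hu
        rw [← hev, ← h, untrop_termValue] at h1
        exact lt_irrefl _ h1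
      by_cases hue : u = e
      · exact hother v (fun h => huv (hue.trans h.symm)) hv
      · exact hother u hue hu
  · by_cases hne : f.coeff.support.Nonempty
    swap
    · left
      rw [Finset.not_nonempty_iff_eq_empty] at hne
      simp [eval, hne]
    right
    obtain ⟨e, he, hmin⟩ := Finset.exists_min_image _ (tilt (linearForm w) (coeffFun f)) hne
    have hle : ∀ u, tilt (linearForm w) (coeffFun f) e ≤ tilt (linearForm w) (coeffFun f) u := by
      intro u
      by_cases hu : u ∈ f.coeff.support
      · exact hmin u hu
      · rw [(tilt_eq_top_iff.2 (coeffFun_eq_top_iff.2 (by simpa using hu)) :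
          tilt (linearForm w) (coeffFun f) u = ⊤)]
        exact le_top
    have htop : tilt (linearForm w) (coeffFun f) e ≠ ⊤ := by
      rw [Ne, tilt_eq_top_iff, coeffFun_eq_top_iff]
      simpa using he
    obtain ⟨v, hve, hv⟩ : ∃ v, v ≠ e ∧
        tilt (linearForm w) (coeffFun f) v ≤ tilt (linearForm w) (coeffFun f) e := by
      by_contra! hcon
      exact h ⟨e, htop, hcon⟩
    have hev := untrop_eval_eq hle
    exact ⟨e, v, hve.symm, Tropical.untrop_injective hev.symm,
      Tropical.untrop_injective (((hle v).antisymm hv).symm.trans hev.symm)⟩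

section Elimination

variable {σ τ : Type*}

lemma extendExponent_injective : Function.Injective (extendExponent σ τ) := fun _ _ h =>
  funext fun j => congrFun h (Sum.inr j)

lemma coeffFun_inclusion_extendExponent (f : TropLaurent τ) (v : τ → ℤ) :
    coeffFun (inclusion σ τ f) (extendExponent σ τ v) = coeffFun f v := by
  simp only [coeffFun]
  congr 1
  exact Finsupp.mapDomain_apply extendExponent_injective _ _

lemma coeffFun_inclusion_of_notMem_range (f : TropLaurent τ) {u : σ ⊕ τ → ℤ}
    (hu : u ∉ Set.range (extendExponent σ τ)) : coeffFun (inclusion σ τ f) u = ⊤ := by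
  rw [coeffFun_eq_top_iff]
  exact Finsupp.mapDomain_of_notMem_range _ _ hu

lemma exists_inclusion_eq (f : TropLaurent (σ ⊕ τ))
    (hf : ∀ u, coeffFun f u ≠ ⊤ → ∀ i, u (Sum.inl i) = 0) : ∃ g, inclusion σ τ g = f := by
  refine ⟨.ofCoeff (f.coeff.comapDomain _ extendExponent_injective.injOn), ?_⟩
  refine AddMonoidAlgebra.coeff_injective ?_
  refine Finsupp.mapDomain_comapDomain _ extendExponent_injective _ fun u hu => ?_
  refine ⟨fun j => u (Sum.inr j), funext fun k => ?_⟩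
  rcases k with i | j
  · refine (hf u ?_ i).symm
    rw [Ne, coeffFun_eq_top_iff]
    simpa using hu
  · rfl

variable [Fintype σ] [Fintype τ]

lemma linearForm_extendExponent (w : σ ⊕ τ → ℝ) (v : τ → ℤ) :
    linearForm w (extendExponent σ τ v) = linearForm (proj w) v := by
  simp [linearForm, extendExponent, proj]

lemma isUniqueMin_inclusion_iff {w : σ ⊕ τ → ℝ} {f : TropLaurent τ} {v : τ → ℤ} :
    IsUniqueMin (tilt (linearForm w) (coeffFun (inclusion σ τ f))) (extendExponent σ τ v) ↔
      IsUniqueMin (tilt (linearForm (proj w)) (coeffFun f)) v := by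
  have key : ∀ v, tilt (linearForm w) (coeffFun (inclusion σ τ f)) (extendExponent σ τ v) =
      tilt (linearForm (proj w)) (coeffFun f) v := fun v => by
    simp only [tilt, coeffFun_inclusion_extendExponent, linearForm_extendExponent]
  refine ⟨fun h => ⟨key v ▸ h.1, fun u hu => ?_⟩, fun h => ⟨(key v).symm ▸ h.1, fun u hu => ?_⟩⟩
  · rw [← key, ← key]
    exact h.2 _ (extendExponent_injective.ne hu)
  · by_cases hr : u ∈ Set.range (extendExponent σ τ)
    · obtain ⟨u, rfl⟩ := hr
      rw [key, key]
      exact h.2 u fun h => hu (by rw [h])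
    · rw [tilt_eq_top_iff.2 (coeffFun_inclusion_of_notMem_range f hr), key]
      exact lt_top_iff_ne_top.2 h.1

theorem variety_eliminationIdeal {I : Ideal (TropLaurent (σ ⊕ τ))} (hI : IsTropicalIdeal I) :
    variety (eliminationIdeal I) = proj '' variety I := by
  classical
  refine Set.Subset.antisymm (fun w hw => ?_) ?_
  swap
  · rintro _ ⟨w, hw, rfl⟩
    rw [mem_variety_iff] at hw ⊢
    rintro f hf ⟨v, hv⟩
    exact hw _ hf ⟨_, isUniqueMin_inclusion_iff.2 hv⟩
  rw [mem_variety_iff] at hw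
  set w₀ : σ ⊕ τ → ℝ := Sum.elim 0 w
  have hT := (isTropFamily_coeffFun hI).tilt (linearForm_sub w₀)
  obtain ⟨a, ha, haT⟩ := exists_forall_not_isUniqueMin (Finset.univ.image Sum.inl) _ hT (by
    rintro F hF hFX ⟨e, he⟩
    -- translating the minimum to `0` makes a homogeneous member a polynomial in `y` alone
    have hF' := hT.translate F hF (-e)
    obtain ⟨_, ⟨f, hf, rfl⟩, hfF⟩ := hF'
    have he0 : IsUniqueMin (tilt (linearForm w₀) (coeffFun f)) 0 := by
      rw [hfF]
      refine ⟨by simpa using he.1, fun u hu => ?_⟩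
      simpa using he.2 (u + e) (by simpa using hu)
    obtain ⟨g, rfl⟩ := exists_inclusion_eq f (by
      intro u hu i
      have h1 : F (u + e) ≠ ⊤ := by
        have := congrFun hfF u
        simp only [sub_neg_eq_add] at this
        rw [← this, Ne, tilt_eq_top_iff]
        exact hu
      simpa using hFX (Sum.inl i) (by simp) _ _ h1 he.1)
    refine hw g hf ⟨0, ?_⟩
    have h2 : proj w₀ = w := rfl
    rw [← h2, ← isUniqueMin_inclusion_iff, map_zero]
    exact he0)
  refine ⟨w₀ + a, mem_variety_iff.2 fun f hf => ?_, ?_⟩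
  · have h1 := haT _ ⟨_, ⟨f, hf, rfl⟩, rfl⟩
    rw [tilt_tilt] at h1
    have h2 : linearForm w₀ + linearForm a = linearForm (w₀ + a) := by
      funext u
      rw [linearForm_add_left]; rfl
    rwa [h2] at h1
  · funext j
    simp [proj, w₀, ha (Sum.inr j) (by simp)]

end Elimination

end Final

end TropLaurent

theorem theoremt (n m : ℕ) (I : Ideal (TropLaurent (Fin n ⊕ Fin m)))
    (hI : TropLaurent.IsTropicalIdeal I) :
    TropLaurent.variety (TropLaurent.eliminationIdeal I) =
      TropLaurent.proj '' TropLaurent.variety I :=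
  TropLaurent.variety_eliminationIdeal hI
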